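/- Let $\mathcal{Q}$ be a small quantaloid, i.e. a small category whose hom-sets are complete lattices and whose composition preserves arbitrary joins in each variable; for $u:p\to q$ and $w:p\to r$ let $w\swarrow u:q\to r$ be the largest $v$ with $v\circ u\le w$. A (small) $\mathcal{Q}$-category $\mathbb{X}$ is a set $\mathbb{X}_0$ with a type map $|\cdot|:\mathbb{X}_0\to\operatorname{ob}\mathcal{Q}$ and arrows $\mathbb{X}(x,y):|x|\to|y|$ such that $1_{|x|}\le\mathbb{X}(x,x)$ and $\mathbb{X}(y,z)\circ\mathbb{X}(x,y)\le\mathbb{X}(x,z)$; its underlying preorder is given by $x\le y$ iff $|x|=|y|$ and $1_{|x|}\le\mathbb{X}(x,y)$. A $\mathcal{Q}$-functor $f:\mathbb{X}\to\mathbb{Y}$ is a type-preserving map with $\mathbb{X}(x,x')\le\mathbb{Y}(fx,fx')$; $\mathcal{Q}$-functors are preordered pointwise. A presheaf $\mu$ on $\mathbb{X}$ of type $|\mu|=q$ is a family of arrows $\mu(x):|x|\to q$ with $\mu(y)\circ\mathbb{X}(x,y)\le\mu(x)$; presheaves on $\mathbb{X}$ form a $\mathcal{Q}$-category $\mathsf{P}\mathbb{X}$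 with $\mathsf{P}\mathbb{X}(\mu,\mu')=\bigwedge_x\mu'(x)\swarrow\mu(x)$. Each $\mathcal{Q}$-functor $f:\mathbb{X}\to\mathbb{Y}$ induces a $\mathcal{Q}$-functor $f^{\to}:\mathsf{P}\mathbb{X}\to\mathsf{P}\mathbb{Y}$, $(f^{\to}\mu)(y)=\bigvee_x\mu(x)\circ\mathbb{Y}(y,fx)$. A $\mathcal{Q}$-closure space $(\mathbb{X},c)$ is a $\mathcal{Q}$-category $\mathbb{X}$ with a $\mathcal{Q}$-functor $c:\mathsf{P}\mathbb{X}\to\mathsf{P}\mathbb{X}$ such that $1\le c$ and $cc\le c$; a continuous $\mathcal{Q}$-functor $f:(\mathbb{X},c)\to(\mathbb{Y},d)$ is a $\mathcal{Q}$-functor $f:\mathbb{X}\to\mathbb{Y}$ with $f^{\to}c\le df^{\to}$. Let $\mathcal{Q}\text{-}\mathbf{CatCls}$ be the category of $\mathcal{Q}$-closure spaces and continuous $\mathcal{Q}$-functors. A locally small category $\mathcal{C}$ is totally cocomplete if every (possibly large) diagram $D:\mathcal{J}\to\mathcal{C}$ has a colimit in $\mathcal{C}$ whenever the colimit of $\mathcal{C}(X,D-)$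 exists in $\mathbf{Set}$ for all objects $X$ of $\mathcal{C}$; it is totally complete if $\mathcal{C}^{\mathrm{op}}$ is totally cocomplete. Then $\mathcal{Q}\text{-}\mathbf{CatCls}$ is totally cocomplete and totally complete; in particular, it has all small colimits and all small limits. -/

import Mathlib

open CategoryTheory CategoryTheory.Limits Opposite

universe w' w v u

/-- A quantaloid: a category whose hom-sets are complete lattices and whose composition preserves
arbitrary joins in each variable. (Arrows compose in diagrammatic order: `u ≫ v` is `v ∘ u`.) -/
class Quantaloid (Q : Type u) extends Category.{v} Q where
  homLattice : ∀ p q : Q, CompleteLattice (p ⟶ q)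
  sSup_comp : ∀ {p q r : Q} (S : Set (p ⟶ q)) (v : q ⟶ r), sSup S ≫ v = ⨆ u ∈ S, u ≫ v
  comp_sSup : ∀ {p q r : Q} (u : p ⟶ q) (S : Set (q ⟶ r)), u ≫ sSup S = ⨆ v ∈ S, u ≫ v

attribute [reducible, instance] Quantaloid.homLattice

namespace Quantaloid

variable {Q : Type u} [Quantaloid.{v} Q]

theorem iSup_comp {p q r : Q} {ι : Sort*} (f : ι → (p ⟶ q)) (v : q ⟶ r) :
    (⨆ i, f i) ≫ v = ⨆ i, f i ≫ v := by
  rw [iSup, sSup_comp, iSup_range]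

theorem comp_iSup {p q r : Q} {ι : Sort*} (u : p ⟶ q) (f : ι → (q ⟶ r)) :
    u ≫ (⨆ i, f i) = ⨆ i, u ≫ f i := by
  rw [iSup, comp_sSup, iSup_range]

theorem comp_le_comp {p q r : Q} {u u' : p ⟶ q} {v v' : q ⟶ r} (hu : u ≤ u') (hv : v ≤ v') :
    u ≫ v ≤ u' ≫ v' := by
  have h1 : u ≫ v ≤ u' ≫ v := by
    have := sSup_comp {u, u'} v
    rw [sSup_pair, sup_eq_right.2 hu] at this
    rw [this]
    exact le_iSup₂_of_le u (by simp) le_rfl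
  have h2 : u' ≫ v ≤ u' ≫ v' := by
    have := comp_sSup u' {v, v'}
    rw [sSup_pair, sup_eq_right.2 hv] at this
    rw [this]
    exact le_iSup₂_of_le v (by simp) le_rfl
  exact h1.trans h2

/-- The left implication `w ↙ u`: the largest arrow `v` with `v ∘ u ≤ w`. -/
def leftImp {p q r : Q} (w : p ⟶ r) (u : p ⟶ q) : q ⟶ r := sSup {v | u ≫ v ≤ w}

theorem le_leftImp_iff {p q r : Q} {w : p ⟶ r} {u : p ⟶ q} {v : q ⟶ r} :
    v ≤ leftImp w u ↔ u ≫ v ≤ w := by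
  constructor
  · intro h
    refine (comp_le_comp le_rfl h).trans ?_
    rw [leftImp, comp_sSup]
    exact iSup₂_le fun _ hv => hv
  · intro h
    exact le_sSup h

end Quantaloid

open Quantaloid

/-- A small category enriched in the small quantaloid `Q`: a set `Obj` with a type map
`type : Obj → Q` and arrows `hom x y : |x| ⟶ |y|` which are reflexive and transitive. -/
structure QCategory (Q : Type u) [Quantaloid.{u} Q] where
  Obj : Type u
  type : Obj → Q
  hom : ∀ x y : Obj, type x ⟶ type y
  one_le : ∀ x, 𝟙 (type x) ≤ hom x x
  comp_le : ∀ x y z, hom x y ≫ hom y z ≤ hom x z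

section

variable {Q : Type u} [Quantaloid.{u} Q]

/-- The underlying preorder of a `Q`-category: `x ≤ y` iff `|x| = |y| = q` and
`1_q ≤ X(x, y)`. -/
def QCategory.Le (X : QCategory Q) (x y : X.Obj) : Prop :=
  ∃ h : X.type x = X.type y, eqToHom h ≤ X.hom x y

theorem QCategory.Le.refl (X : QCategory Q) (x : X.Obj) : X.Le x x :=
  ⟨rfl, X.one_le x⟩

theorem QCategory.Le.trans {X : QCategory Q} {x y z : X.Obj} (h : X.Le x y) (h' : X.Le y z) :
    X.Le x z := by
  obtain ⟨e, h⟩ := h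
  obtain ⟨e', h'⟩ := h'
  refine ⟨e.trans e', ?_⟩
  rw [← eqToHom_trans e e']
  exact (comp_le_comp h h').trans (X.comp_le _ _ _)

/-- A `Q`-functor: a type-preserving map with `X(x, x') ≤ Y(f x, f x')`; the right-hand side is
transported along the equalities of types `|f x| = |x|` and `|f x'| = |x'|`. -/
@[ext]
structure QFunctor (X Y : QCategory Q) where
  toFun : X.Obj → Y.Obj
  type_eq : ∀ x, Y.type (toFun x) = X.type x
  hom_le : ∀ x x', X.hom x x' ≤
    eqToHom (type_eq x).symm ≫ Y.hom (toFun x) (toFun x') ≫ eqToHom (type_eq x')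

namespace QFunctor

variable {X Y Z : QCategory Q}

/-- The identity `Q`-functor. -/
def id (X : QCategory Q) : QFunctor X X where
  toFun x := x
  type_eq _ := rfl
  hom_le _ _ := by simp

/-- Composition of `Q`-functors (first `f`, then `g`). -/
def comp (f : QFunctor X Y) (g : QFunctor Y Z) : QFunctor X Z where
  toFun x := g.toFun (f.toFun x)
  type_eq x := (g.type_eq _).trans (f.type_eq x)
  hom_le x x' := by
    refine (f.hom_le x x').trans ?_
    refine (comp_le_comp le_rfl (comp_le_comp (g.hom_le _ _) le_rfl)).trans ?_
    simp

/-- The pointwise order of `Q`-functors. -/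
def Le (f g : QFunctor X Y) : Prop := ∀ x, Y.Le (f.toFun x) (g.toFun x)

/-- A `Q`-functor is monotone for the underlying preorders. -/
theorem mono (f : QFunctor X Y) {x x' : X.Obj} (h : X.Le x x') :
    Y.Le (f.toFun x) (f.toFun x') := by
  obtain ⟨e, h⟩ := h
  refine ⟨(f.type_eq x).trans (e.trans (f.type_eq x').symm), ?_⟩
  have h2 := comp_le_comp (le_refl (eqToHom (f.type_eq x)))
    (comp_le_comp (h.trans (f.hom_le x x')) (le_refl (eqToHom (f.type_eq x').symm)))
  simpa using h2

end QFunctor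

/-- A presheaf on `X`: a type `q` and arrows `μ(x) : |x| ⟶ q` with `μ(y) ∘ X(x, y) ≤ μ(x)`,
i.e. a distributor from `X` to the one-object discrete `Q`-category on `q`. -/
structure QPresheaf (X : QCategory Q) where
  type : Q
  app : ∀ x : X.Obj, X.type x ⟶ type
  hom_comp_le : ∀ x y, X.hom x y ≫ app y ≤ app x

/-- The `Q`-category `PX` of presheaves on `X`, with `PX(μ, μ') = ⋀ₓ μ'(x) ↙ μ(x)`. -/
abbrev QCategory.presheaves (X : QCategory Q) : QCategory Q where
  Obj := QPresheaf X
  type μ := μ.type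
  hom μ μ' := ⨅ x, leftImp (μ'.app x) (μ.app x)
  one_le μ := le_iInf fun x => le_leftImp_iff.2 (by simp)
  comp_le μ μ' μ'' := by
    refine le_iInf fun x => le_leftImp_iff.2 ?_
    rw [← Category.assoc]
    refine (comp_le_comp (le_leftImp_iff.1 (iInf_le _ x)) le_rfl).trans ?_
    exact le_leftImp_iff.1 (iInf_le _ x)

namespace QFunctor

variable {X Y Z : QCategory Q}

/-- The `Q`-functor `f^→ : PX ⟶ PY` induced by `f : X ⟶ Y`: composition with the cograph
`Y(-, f -)` of `f`, i.e. `(f^→ μ)(y) = ⋁ₓ μ(x) ∘ Y(y, f x)`. -/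
def image (f : QFunctor X Y) : QFunctor X.presheaves Y.presheaves where
  toFun μ :=
    { type := μ.type
      app := fun y => ⨆ x, Y.hom y (f.toFun x) ≫ eqToHom (f.type_eq x) ≫ μ.app x
      hom_comp_le := fun y y' => by
        rw [comp_iSup]
        refine iSup_mono fun x => ?_
        rw [← Category.assoc]
        exact comp_le_comp (Y.comp_le _ _ _) le_rfl }
  type_eq _ := rfl
  hom_le μ μ' := by
    simp only [eqToHom_refl, Category.comp_id, Category.id_comp]
    refine le_iInf fun y => le_leftImp_iff.2 ?_
    rw [iSup_comp]
    refine iSup_mono fun x => ?_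
    simp only [Category.assoc]
    exact comp_le_comp le_rfl (comp_le_comp le_rfl (le_leftImp_iff.1 (iInf_le _ x)))

theorem image_id (μ : QPresheaf X) : (QFunctor.id X).image.toFun μ = μ := by
  obtain ⟨q, m, hm⟩ := μ
  simp only [image, id, QPresheaf.mk.injEq, heq_eq_eq, true_and]
  funext y
  refine le_antisymm (iSup_le fun x => ?_) (le_iSup_of_le y ?_)
  · simpa using hm y x
  · simpa using comp_le_comp (X.one_le y) (le_refl (m y))

theorem image_comp (f : QFunctor X Y) (g : QFunctor Y Z) (μ : QPresheaf X) :
    (f.comp g).image.toFun μ = g.image.toFun (f.image.toFun μ) := by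
  obtain ⟨q, m, hm⟩ := μ
  simp only [image, comp, QPresheaf.mk.injEq, heq_eq_eq, true_and]
  funext z
  refine le_antisymm (iSup_le fun x => ?_) (iSup_le fun y => ?_)
  · refine le_iSup_of_le (f.toFun x) ?_
    rw [comp_iSup, comp_iSup]
    refine le_iSup_of_le x ?_
    have h := comp_le_comp (Y.one_le (f.toFun x)) (le_refl (eqToHom (f.type_eq x) ≫ m x))
    rw [Category.id_comp] at h
    refine le_trans (le_of_eq ?_) (comp_le_comp le_rfl (comp_le_comp le_rfl h))
    simp
  · rw [comp_iSup, comp_iSup]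
    refine iSup_mono fun x => ?_
    refine (comp_le_comp le_rfl (comp_le_comp le_rfl
      (comp_le_comp (g.hom_le y (f.toFun x)) le_rfl))).trans ?_
    have h := comp_le_comp (Z.comp_le z (g.toFun y) (g.toFun (f.toFun x)))
      (le_refl (eqToHom ((g.type_eq _).trans (f.type_eq x)) ≫ m x))
    simpa using h

end QFunctor

/-- A `Q`-closure operator on `X`: a `Q`-functor `c : X ⟶ X` with `1 ≤ c` and `c c ≤ c`. -/
structure QClosureOperator (X : QCategory Q) extends QFunctor X X where
  id_le : (QFunctor.id X).Le toQFunctor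
  comp_self_le : (toQFunctor.comp toQFunctor).Le toQFunctor

variable (Q) in
/-- A `Q`-closure space: a `Q`-category `X` with a `Q`-closure operator on `PX`. -/
structure QClosureSpace where
  cat : QCategory Q
  cl : QClosureOperator cat.presheaves

/-- A `Q`-functor `f : (X, c) ⟶ (Y, d)` is continuous if `f^→ c ≤ d f^→`. -/
def QFunctor.IsContinuous {X Y : QClosureSpace Q} (f : QFunctor X.cat Y.cat) : Prop :=
  (X.cl.toQFunctor.comp f.image).Le (f.image.comp Y.cl.toQFunctor)

/-- Continuous `Q`-functors between `Q`-closure spaces. -/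
@[ext]
structure QClosureSpace.Hom (X Y : QClosureSpace Q) where
  functor : QFunctor X.cat Y.cat
  continuous : functor.IsContinuous

instance : Category (QClosureSpace Q) where
  Hom := QClosureSpace.Hom
  id X :=
    { functor := QFunctor.id X.cat
      continuous := fun μ => by
        simp only [QFunctor.comp, QFunctor.image_id]
        exact QCategory.Le.refl _ _ }
  comp {X Y Z} f g :=
    { functor := f.functor.comp g.functor
      continuous := fun μ => by
        have h1 := g.functor.image.mono (f.continuous μ)
        have h2 := g.continuous (f.functor.image.toFun μ)
        simp only [QFunctor.comp] at h1 h2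
        simp only [QFunctor.comp]
        have e1 := QFunctor.image_comp f.functor g.functor μ
        have e2 := QFunctor.image_comp f.functor g.functor (X.cl.toFun μ)
        simp only [QFunctor.comp] at e1 e2
        rw [e1, e2]
        exact h1.trans h2 }

end

/-- A category `C` is totally cocomplete if every diagram `D : J ⥤ C` (with `J` possibly large) has
a colimit as soon as, for each `X : C`, the diagram of sets `C(X, D -)` has a colimit in the
category of sets in which `C` has its hom-sets. -/
def TotallyCocomplete (C : Type u) [Category.{v} C] : Prop :=
  ∀ (J : Type w) [Category.{w'} J] (D : J ⥤ C),
    (∀ X : C, HasColimit (D ⋙ coyoneda.obj (op X))) → HasColimit D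

/-- A category is totally complete if its opposite is totally cocomplete. -/
def TotallyComplete (C : Type u) [Category.{v} C] : Prop :=
  TotallyCocomplete.{w', w} Cᵒᵖ

section

variable {Q : Type u} [Quantaloid.{u} Q]

/-! The forgetful functor to sets typed over `Q` is topological: any family of type-preserving maps
into closure spaces, even a large one, has an initial structure, since hom-arrows and closure
operators are meets in complete lattices (`isHom_initial`). So only the underlying typed sets of
limits and colimits need care. For colimits, `point q` represents the elements of type `q`, so the
hypothesis at these objects yields the underlying set fibre by fibre; it receives the final
structure, which is the initial one for all admissible maps out. For limits, the underlying set
consists of the compatible typed families, and the only obstruction is size. Maps into the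
indiscrete space `twoPoints` separate elements, so the hypothesis at that one object bounds the
number of families. -/

theorem Quantaloid.eqToHom_comp_le_iff {p q r : Q} (e : p = q) (u : q ⟶ r) (v : p ⟶ r) :
    eqToHom e ≫ u ≤ v ↔ u ≤ eqToHom e.symm ≫ v := by
  subst e
  simp

theorem Quantaloid.comp_eqToHom_le_iff {p q r : Q} (e : q = r) (u : p ⟶ q) (v : p ⟶ r) :
    u ≫ eqToHom e ≤ v ↔ u ≤ v ≫ eqToHom e.symm := by
  subst e
  simp

theorem Quantaloid.le_eqToHom_comp_comp_eqToHom {p q : Q} {u v : p ⟶ q} (h : u ≤ v) (e : p = p)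
    (e' : q = q) : u ≤ eqToHom e ≫ v ≫ eqToHom e' := by
  simpa using h

/-! ### Meets of presheaves. -/

namespace QPresheaf

variable {X : QCategory Q}

theorem le_iff {μ ν : QPresheaf X} : X.presheaves.Le μ ν ↔
    ∃ e : μ.type = ν.type, ∀ x, μ.app x ≫ eqToHom e ≤ ν.app x := by
  refine exists_congr fun e => ?_
  exact le_iInf_iff.trans (forall_congr' fun x => le_leftImp_iff)

/-- The pointwise meet of a family of presheaves of the same type `q`. -/
def meet {ι : Sort*} (q : Q) (ν : ι → QPresheaf X) (e : ∀ i, (ν i).type = q) : QPresheaf X where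
  type := q
  app x := ⨅ i, (ν i).app x ≫ eqToHom (e i)
  hom_comp_le x y := by
    refine le_iInf fun i => (comp_le_comp le_rfl (iInf_le _ i)).trans ?_
    rw [← Category.assoc]
    exact comp_le_comp ((ν i).hom_comp_le x y) le_rfl

/-- The condition on types is stated separately because an empty family does not imply it. -/
theorem le_meet_iff {ι : Sort*} {q : Q} {ν : ι → QPresheaf X} {e : ∀ i, (ν i).type = q}
    {μ : QPresheaf X} :
    X.presheaves.Le μ (meet q ν e) ↔ μ.type = q ∧ ∀ i, X.presheaves.Le μ (ν i) := by
  simp only [le_iff]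
  constructor
  · rintro ⟨h, H⟩
    have h' : μ.type = q := h
    refine ⟨h', fun i => ⟨h'.trans (e i).symm, fun x => ?_⟩⟩
    have H' : μ.app x ≫ eqToHom h' ≤ (ν i).app x ≫ eqToHom (e i) := (H x).trans (iInf_le _ i)
    simpa using (comp_eqToHom_le_iff (e i).symm _ _).2 H'
  · rintro ⟨h, H⟩
    refine ⟨h, fun x => le_iInf fun i => ?_⟩
    obtain ⟨h', H⟩ := H i
    refine (comp_eqToHom_le_iff (e i).symm (μ.app x ≫ eqToHom h) _).1 ?_
    simpa using H x

theorem meet_le {ι : Sort*} {q : Q} {ν : ι → QPresheaf X} {e : ∀ i, (ν i).type = q} (i : ι) :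
    X.presheaves.Le (meet q ν e) (ν i) :=
  (le_meet_iff.1 (QCategory.Le.refl _ _)).2 i

end QPresheaf

/-! ### Restriction of presheaves and meets of functors. -/

namespace QFunctor

variable {X Y : QCategory Q}

/-- The `Q`-functor `f^← : PY ⟶ PX`, restriction along `f`, right adjoint to `f^→`. -/
def preimage (f : QFunctor X Y) : QFunctor Y.presheaves X.presheaves where
  toFun ν :=
    { type := ν.type
      app := fun x => eqToHom (f.type_eq x).symm ≫ ν.app (f.toFun x)
      hom_comp_le := fun x y => by
        refine (comp_le_comp (f.hom_le x y) le_rfl).trans ?_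
        simpa using comp_le_comp (le_refl (eqToHom (f.type_eq x).symm))
          (ν.hom_comp_le (f.toFun x) (f.toFun y)) }
  type_eq _ := rfl
  hom_le ν ν' := by
    simp only [eqToHom_refl, Category.comp_id, Category.id_comp]
    refine le_iInf fun x => le_leftImp_iff.2 ?_
    rw [Category.assoc]
    exact comp_le_comp le_rfl (le_leftImp_iff.1 (iInf_le _ _))

/-- The adjunction between image and restriction, a Yoneda argument: one direction evaluates at `f
x` and uses reflexivity of `Y`, the other uses that `Y` acts on `ν`. It lets continuity be tested as
`c ≤ f^← d f^→`. -/
theorem image_le_iff (f : QFunctor X Y) {μ : QPresheaf X} {ν : QPresheaf Y} :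
    Y.presheaves.Le (f.image.toFun μ) ν ↔ X.presheaves.Le μ (f.preimage.toFun ν) := by
  simp only [QPresheaf.le_iff]
  refine exists_congr fun e => ?_
  constructor
  · intro H x
    have h := comp_le_comp (Y.one_le (f.toFun x))
      (le_refl (eqToHom (f.type_eq x) ≫ μ.app x ≫ eqToHom e))
    rw [Category.id_comp] at h
    have := H (f.toFun x)
    refine (eqToHom_comp_le_iff (f.type_eq x) _ _).1 (h.trans (le_trans ?_ this))
    simp only [image, iSup_comp]
    exact le_iSup_of_le x (by simp)
  · intro H y
    simp only [image, iSup_comp, Category.assoc]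
    refine iSup_le fun x => ?_
    refine (comp_le_comp le_rfl ((eqToHom_comp_le_iff _ _ _).2 (H x))).trans ?_
    exact ν.hom_comp_le _ _

/-- The pointwise meet of a family of `Q`-functors into a presheaf `Q`-category. -/
def meet {ι : Sort*} (F : ι → QFunctor X Y.presheaves) : QFunctor X Y.presheaves where
  toFun x := QPresheaf.meet (X.type x) (fun i => (F i).toFun x) fun i => (F i).type_eq x
  type_eq _ := rfl
  hom_le x x' := by
    refine le_eqToHom_comp_comp_eqToHom (p := X.type x) (q := X.type x') ?_ rfl rfl
    refine le_iInf fun y => le_leftImp_iff.2 (le_iInf fun i => ?_)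
    have h := comp_le_comp (le_leftImp_iff.1
      (iInf_le (fun y => leftImp (((F i).toFun x').app y) (((F i).toFun x).app y)) y))
      (le_refl (eqToHom ((F i).type_eq x')))
    refine (comp_le_comp (iInf_le _ i) ((F i).hom_le x x')).trans ?_
    simpa using h

end QFunctor

/-- The initial `Q`-category structure on a typed set for a family of type-preserving maps. -/
def QCategory.initial {ι : Sort*} {Z : Type u} (ty : Z → Q) (W : ι → QCategory Q)
    (g : ∀ i, Z → (W i).Obj) (hg : ∀ i z, (W i).type (g i z) = ty z) : QCategory Q where
  Obj := Z
  type := ty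
  hom z z' := ⨅ i, eqToHom (hg i z).symm ≫ (W i).hom (g i z) (g i z') ≫ eqToHom (hg i z')
  one_le z := le_iInf fun i => by
    rw [← eqToHom_comp_le_iff (hg i z)]
    simpa using comp_le_comp ((W i).one_le (g i z)) (le_refl (eqToHom (hg i z)))
  comp_le x y z := le_iInf fun i => by
    refine (comp_le_comp (iInf_le _ i) (iInf_le _ i)).trans ?_
    simpa using comp_le_comp (le_refl (eqToHom (hg i x).symm))
      (comp_le_comp ((W i).comp_le (g i x) (g i y) (g i z)) (le_refl (eqToHom (hg i z))))

/-- The structure maps out of the initial `Q`-category. -/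
def QCategory.initialFunctor {ι : Sort*} {Z : Type u} (ty : Z → Q) (W : ι → QCategory Q)
    (g : ∀ i, Z → (W i).Obj) (hg : ∀ i z, (W i).type (g i z) = ty z) (i : ι) :
    QFunctor (QCategory.initial ty W g hg) (W i) where
  toFun := g i
  type_eq := hg i
  hom_le _ _ := iInf_le _ i

/-- The initial `Q`-closure operator for a family of `Q`-functors into `Q`-closure spaces:
the pointwise meet of the operators `g^← d g^→`. -/
def QClosureOperator.initial {ι : Sort*} {X : QCategory Q} (W : ι → QClosureSpace Q)
    (g : ∀ i, QFunctor X (W i).cat) : QClosureOperator X.presheaves where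
  toQFunctor := QFunctor.meet fun i =>
    (g i).image.comp ((W i).cl.toQFunctor.comp (g i).preimage)
  id_le _ := QPresheaf.le_meet_iff.2 ⟨rfl, fun i =>
    (g i).image_le_iff.1 ((W i).cl.id_le _)⟩
  -- Writing `c` for the meet, `g^→ c ≤ d g^→` by adjunction, hence `g^← d g^→ c ≤ g^← d d g^→ ≤ g^←
  -- d g^→`.
  comp_self_le _ := QPresheaf.le_meet_iff.2 ⟨rfl, fun i =>
    (QPresheaf.meet_le i).trans ((g i).preimage.mono
      (((W i).cl.mono ((g i).image_le_iff.2 (QPresheaf.meet_le i))).trans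
        ((W i).cl.comp_self_le _)))⟩

/-! ### Morphisms and initial structures. -/

namespace QClosureSpace

/-- A map of underlying sets is a morphism if it underlies a continuous `Q`-functor. -/
def IsHom (X Y : QClosureSpace Q) (f : X.cat.Obj → Y.cat.Obj) : Prop :=
  ∃ φ : X ⟶ Y, φ.functor.toFun = f

theorem hom_ext {X Y : QClosureSpace Q} {f g : X ⟶ Y}
    (h : ∀ x, f.functor.toFun x = g.functor.toFun x) : f = g :=
  QClosureSpace.Hom.ext (QFunctor.ext (funext h))

theorem comp_functor_toFun {X Y Z : QClosureSpace Q} (f : X ⟶ Y) (g : Y ⟶ Z) (x : X.cat.Obj) :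
    (f ≫ g).functor.toFun x = g.functor.toFun (f.functor.toFun x) := rfl

section Initial

variable {ι : Sort*} {Z : Type u} (ty : Z → Q) (W : ι → QClosureSpace Q)
  (g : ∀ i, Z → (W i).cat.Obj) (hg : ∀ i z, (W i).cat.type (g i z) = ty z)

/-- The initial `Q`-closure space structure on a typed set for a (possibly large) family of
type-preserving maps into `Q`-closure spaces. -/
def initial : QClosureSpace Q where
  cat := QCategory.initial ty (fun i => (W i).cat) g hg
  cl := QClosureOperator.initial W (QCategory.initialFunctor ty (fun i => (W i).cat) g hg)

/-- The structure maps out of the initial `Q`-closure space. -/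
def initialMap (i : ι) : initial ty W g hg ⟶ W i where
  functor := QCategory.initialFunctor ty (fun i => (W i).cat) g hg i
  continuous _ := (QFunctor.image_le_iff _).2 (QPresheaf.meet_le i)

/-- The universal property of the initial structure. The hom inequality is checked in each component
of the meet; for continuity, adjunction turns each component into continuity of the composite with
`g i`. -/
theorem isHom_initial (B : QClosureSpace Q) (h : B.cat.Obj → Z)
    (hty : ∀ b, ty (h b) = B.cat.type b) (H : ∀ i, IsHom B (W i) fun b => g i (h b)) :
    IsHom B (initial ty W g hg) h := by
  let F : QFunctor B.cat (initial ty W g hg).cat :=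
    { toFun := h
      type_eq := hty
      hom_le := fun b b' => by
        refine (eqToHom_comp_le_iff (hty b) _ _).1
          ((comp_eqToHom_le_iff (hty b').symm _ _).1 (le_iInf fun i => ?_))
        obtain ⟨⟨⟨f, ft, fh⟩, fc⟩, hφ⟩ := H i
        obtain rfl : f = fun b => g i (h b) := hφ
        refine (comp_eqToHom_le_iff _ _ _).2 ((eqToHom_comp_le_iff _ _ _).2 ?_)
        refine (fh b b').trans (le_of_eq ?_)
        simp }
  refine ⟨⟨F, fun μ => QPresheaf.le_meet_iff.2 ⟨B.cl.type_eq μ, fun i => ?_⟩⟩, rfl⟩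
  refine (QFunctor.image_le_iff _).1 ?_
  obtain ⟨φ, hφ⟩ := H i
  have e : φ.functor = F.comp (initialMap ty W g hg i).functor := QFunctor.ext hφ
  have hc := φ.continuous μ
  rw [e] at hc
  simp only [QFunctor.comp] at hc
  have e1 := fun ν => QFunctor.image_comp F (initialMap ty W g hg i).functor ν
  simp only [QFunctor.comp] at e1
  rw [e1, e1] at hc
  exact hc

end Initial

/-- The one-object discrete `Q`-closure space of type `q`. -/
def point (q : Q) : QClosureSpace Q where
  cat :=
    { Obj := PUnit
      type := fun _ => q
      hom := fun _ _ => 𝟙 q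
      one_le := fun _ => le_rfl
      comp_le := fun _ _ _ => by simp }
  cl :=
    { toQFunctor := QFunctor.id _
      id_le := fun _ => QCategory.Le.refl _ _
      comp_self_le := fun _ => QCategory.Le.refl _ _ }

/-- The unique element of the one-point space. -/
def pt (q : Q) : (point q).cat.Obj := PUnit.unit

/-- The morphism from the one-point space of type `q` given by an element of type `q`. -/
def pointMap {X : QClosureSpace Q} {q : Q} (x : X.cat.Obj) (h : X.cat.type x = q) :
    point q ⟶ X where
  functor :=
    { toFun := fun _ => x
      type_eq := fun _ => h
      hom_le := fun _ _ => by
        subst h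
        exact le_eqToHom_comp_comp_eqToHom (X.cat.one_le x) rfl rfl }
  -- The point carries the identity operator, so continuity reduces to `1 ≤ c`.
  continuous _ := X.cl.id_le _

/-- The indiscrete `Q`-closure space on a typed set. -/
def indiscrete {Z : Type u} (ty : Z → Q) : QClosureSpace Q :=
  initial ty (fun i : PEmpty.{1} => i.elim) (fun i => i.elim) (fun i => i.elim)

theorem isHom_indiscrete {Z : Type u} (ty : Z → Q) (B : QClosureSpace Q) (h : B.cat.Obj → Z)
    (hty : ∀ b, ty (h b) = B.cat.type b) : IsHom B (indiscrete ty) h :=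
  isHom_initial _ _ _ _ B h hty fun i => i.elim

/-! ### Colimits from colimits of fibres. -/

section Colimits

theorem cocone_app_comp_map {J : Type w} [Category.{w'} J] (D : J ⥤ QClosureSpace Q)
    (s : Cocone D) {q : Q} {i j : J} (f : i ⟶ j)
    (φ : point q ⟶ D.obj i) : (s.ι.app j).functor.toFun ((φ ≫ D.map f).functor.toFun (pt q)) =
      (s.ι.app i).functor.toFun (φ.functor.toFun (pt q)) := by
  rw [comp_functor_toFun, ← comp_functor_toFun (D.map f), s.w]

variable {J : Type w} [Category.{w'} J] (D : J ⥤ QClosureSpace Q)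
  [∀ q, HasColimit (D ⋙ coyoneda.obj (op (point q)))]

/-- The set of elements of type `q` of the colimit of `D`. -/
abbrev ColimitFiber (q : Q) : Type u := colimit (D ⋙ coyoneda.obj (op (point q)))

/-- The underlying set of the colimit of `D`. -/
abbrev ColimitObj : Type u := Σ q : Q, ColimitFiber D q

/-- The inclusion of points of `D j` into the colimit. -/
noncomputable def colimitFiberι {q : Q} (j : J) (φ : point q ⟶ D.obj j) : ColimitFiber D q :=
  colimit.ι (D ⋙ coyoneda.obj (op (point q))) j φ

theorem colimitFiberι_surjective {q : Q} (z : ColimitFiber D q) :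
    ∃ (j : J) (φ : point q ⟶ D.obj j), colimitFiberι D j φ = z :=
  Types.jointly_surjective _ (colimit.isColimit _) z

theorem colimitFiberι_comp_map {q : Q} {i j : J} (f : i ⟶ j) (φ : point q ⟶ D.obj i) :
    colimitFiberι D j (φ ≫ D.map f) = colimitFiberι D i φ :=
  ConcreteCategory.congr_hom (colimit.w (D ⋙ coyoneda.obj (op (point q))) f) φ

/-- The map out of the colimit fibre induced by a compatible family of maps. -/
noncomputable def colimitFiberDesc {q : Q} {W : Type u} (t : ∀ j, (point q ⟶ D.obj j) → W)
    (ht : ∀ {i j : J} (f : i ⟶ j) (φ : point q ⟶ D.obj i), t j (φ ≫ D.map f) = t i φ) :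
    ColimitFiber D q → W :=
  colimit.desc (D ⋙ coyoneda.obj (op (point q)))
    { pt := W
      ι :=
        { app := fun j => ↾(t j)
          naturality := fun i j f => by
            ext φ
            exact ht f φ } }

theorem colimitFiberDesc_ι {q : Q} {W : Type u} (t : ∀ j, (point q ⟶ D.obj j) → W)
    (ht : ∀ {i j : J} (f : i ⟶ j) (φ : point q ⟶ D.obj i), t j (φ ≫ D.map f) = t i φ)
    (j : J) (φ : point q ⟶ D.obj j) :
    colimitFiberDesc D t ht (colimitFiberι D j φ) = t j φ :=
  ConcreteCategory.congr_hom
    (colimit.ι_desc (F := D ⋙ coyoneda.obj (op (point q))) ⟨W, _⟩ j) φ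

/-- The inclusion of `D j` into the underlying set of the colimit. -/
noncomputable def colimitIncl (j : J) (x : (D.obj j).cat.Obj) : ColimitObj D :=
  ⟨_, colimitFiberι D j (pointMap x rfl)⟩

/-- Replaces the canonical point at `x` by any point hitting `x`, absorbing the change of type in
the sigma type. -/
theorem colimitIncl_eq (j : J) (x : (D.obj j).cat.Obj) {q : Q} (φ : point q ⟶ D.obj j)
    (h : φ.functor.toFun (pt q) = x) : colimitIncl D j x = ⟨q, colimitFiberι D j φ⟩ := by
  have hq : (D.obj j).cat.type x = q := h ▸ φ.functor.type_eq (pt q)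
  subst hq
  have : φ = pointMap x rfl := hom_ext fun _ => h
  rw [this]
  rfl

theorem colimitIncl_surjective (z : ColimitObj D) : ∃ j x, colimitIncl D j x = z := by
  obtain ⟨q, z⟩ := z
  obtain ⟨j, φ, rfl⟩ := colimitFiberι_surjective D z
  exact ⟨j, _, colimitIncl_eq D j _ φ rfl⟩

/-- The map out of the underlying set of the colimit induced by a cocone. -/
noncomputable def colimitDesc (s : Cocone D) (z : ColimitObj D) : s.pt.cat.Obj :=
  colimitFiberDesc D (fun j φ => (s.ι.app j).functor.toFun (φ.functor.toFun (pt z.1)))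
    (cocone_app_comp_map D s) z.2

theorem colimitDesc_incl (s : Cocone D) (j : J) (x : (D.obj j).cat.Obj) :
    colimitDesc D s (colimitIncl D j x) = (s.ι.app j).functor.toFun x :=
  colimitFiberDesc_ι D _ (cocone_app_comp_map D s) j _

theorem type_colimitDesc (s : Cocone D) (z : ColimitObj D) :
    s.pt.cat.type (colimitDesc D s z) = z.1 := by
  obtain ⟨j, x, rfl⟩ := colimitIncl_surjective D z
  rw [colimitDesc_incl]
  exact (s.ι.app j).functor.type_eq x

/-- The type-preserving maps from the underlying set of the colimit of `D` to `Q`-closure spaces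
whose composites with the inclusions are morphisms. -/
structure ColimitTest where
  space : QClosureSpace Q
  map : ColimitObj D → space.cat.Obj
  type_map : ∀ z, space.cat.type (map z) = z.1
  isHom_incl : ∀ j, IsHom (D.obj j) space fun x => map (colimitIncl D j x)

/-- The colimit of `D`: the final structure on the colimit of underlying sets, obtained as the
initial structure for all maps whose composites with the inclusions are morphisms. -/
noncomputable def colimitSpace : QClosureSpace Q :=
  initial (ι := ColimitTest D) Sigma.fst (fun p => p.space) (fun p => p.map)
    (fun p => p.type_map)

theorem isHom_colimitIncl (j : J) : IsHom (D.obj j) (colimitSpace D) (colimitIncl D j) :=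
  isHom_initial _ _ _ _ _ _ (fun _ => rfl) fun p => p.isHom_incl j

/-- The map induced by a cocone is itself one of the tests defining the initial structure. -/
theorem isHom_colimitDesc (s : Cocone D) :
    IsHom (colimitSpace D) s.pt (colimitDesc D s) :=
  ⟨initialMap (ι := ColimitTest D) Sigma.fst (fun p => p.space) (fun p => p.map)
    (fun p => p.type_map) ⟨s.pt, colimitDesc D s, type_colimitDesc D s, fun j =>
      ⟨s.ι.app j, funext fun x => (colimitDesc_incl D s j x).symm⟩⟩, rfl⟩

theorem hasColimit_of_hasColimit_points : HasColimit D := by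
  choose i hi using isHom_colimitIncl D
  choose d hd using isHom_colimitDesc D
  have hi' : ∀ j x, (i j).functor.toFun x = colimitIncl D j x := fun j x => congrFun (hi j) x
  refine HasColimit.mk ⟨⟨colimitSpace D, ⟨i, fun j k f => hom_ext fun x => ?_⟩⟩,
    ⟨d, fun s j => hom_ext fun x => ?_, fun s m hm => hom_ext fun z => ?_⟩⟩
  · rw [comp_functor_toFun, hi']
    refine (colimitIncl_eq D k _ (pointMap x rfl ≫ D.map f) rfl).trans ?_
    rw [colimitFiberι_comp_map]
    exact (hi' j x).symm
  · rw [comp_functor_toFun, hd]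
    exact (congrArg _ (hi' j x)).trans (colimitDesc_incl D s j x)
  · rw [hd]
    obtain ⟨j, x, rfl⟩ := colimitIncl_surjective D z
    rw [colimitDesc_incl, ← hm j, comp_functor_toFun]
    exact congrArg _ (hi' j x).symm

end Colimits

/-! ### Limits from smallness of compatible families. -/

section Limits

/-- Compatible families of elements of the same type `type` in a diagram. -/
@[ext]
structure TypedSection {J : Type w} [Category.{w'} J] (E : J ⥤ QClosureSpace Q) where
  type : Q
  val : ∀ j, (E.obj j).cat.Obj
  type_val : ∀ j, (E.obj j).cat.type (val j) = type
  map_val : ∀ {i j : J} (f : i ⟶ j), (E.map f).functor.toFun (val i) = val j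

/-- A small copy of the typed families, with the initial structure for the projections, is the
limit. The type is part of the data, so an empty diagram gives one element for each type. -/
theorem hasLimit_of_small_typedSection {J : Type w} [Category.{w'} J] (E : J ⥤ QClosureSpace Q)
    [Small.{u} (TypedSection E)] : HasLimit E := by
  let e := equivShrink.{u} (TypedSection E)
  let L : QClosureSpace Q := initial (Z := Shrink.{u} (TypedSection E))
    (fun z => (e.symm z).type) E.obj (fun j z => (e.symm z).val j)
    (fun j z => (e.symm z).type_val j)
  let p : ∀ j, L ⟶ E.obj j := initialMap _ _ _ _
  have hp : ∀ j (z : Shrink.{u} (TypedSection E)), (p j).functor.toFun z = (e.symm z).val j :=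
    fun _ _ => rfl
  let l (s : Cone E) (a : s.pt.cat.Obj) : TypedSection E :=
    { type := s.pt.cat.type a
      val := fun j => (s.π.app j).functor.toFun a
      type_val := fun j => (s.π.app j).functor.type_eq a
      map_val := fun f => by rw [← comp_functor_toFun, s.w] }
  have hl : ∀ s : Cone E, IsHom s.pt L fun a => e (l s a) := fun s =>
    isHom_initial _ _ _ _ _ _ (fun a => by rw [e.symm_apply_apply]) fun j =>
      ⟨s.π.app j, funext fun a => by rw [e.symm_apply_apply]⟩
  choose d hd using hl
  have hd' : ∀ s a, (d s).functor.toFun a = e (l s a) := fun s a => congrFun (hd s) a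
  refine HasLimit.mk ⟨⟨L, ⟨p, fun i j f => hom_ext fun z => ?_⟩⟩,
    ⟨d, fun s j => hom_ext fun a => ?_, fun s m hm => hom_ext fun a => ?_⟩⟩
  · exact ((e.symm z).map_val f).symm
  · rw [comp_functor_toFun, hd']
    exact (hp j _).trans (by rw [e.symm_apply_apply])
  · rw [hd']
    refine e.symm_apply_eq.1 (TypedSection.ext (m.functor.type_eq a) (funext fun j => ?_))
    exact congrArg (fun φ : s.pt ⟶ E.obj j => φ.functor.toFun a) (hm j)

variable (Q) in
/-- The indiscrete space with two elements of each type. -/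
abbrev twoPoints : QClosureSpace Q := indiscrete (Prod.fst : Q × Prop → Q)

/-- A family is determined by its type and by the truth values it assigns to maps into `twoPoints`;
compatibility makes this assignment factor through the given colimit, which is a small set. -/
theorem small_typedSection_leftOp {J : Type w} [Category.{w'} J] (D : J ⥤ (QClosureSpace Q)ᵒᵖ)
    [HasColimit (D ⋙ coyoneda.obj (op (op (twoPoints Q))))] :
    Small.{u} (TypedSection D.leftOp) := by
  let F := D ⋙ coyoneda.obj (op (op (twoPoints Q)))
  let ev (x : TypedSection D.leftOp) : Cocone F :=
    { pt := ULift.{u} Prop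
      ι :=
        { app := fun j => ↾fun φ : op (twoPoints Q) ⟶ D.obj j =>
            ULift.up (φ.unop.functor.toFun (x.val (op j))).2
          naturality := fun i j f => by
            ext φ
            have h := x.map_val f.op
            exact congrArg (fun y => ULift.up (Prod.snd
              ((Quiver.Hom.unop (show op (twoPoints Q) ⟶ D.obj i from φ)).functor.toFun y))) h } }
  have hev : ∀ x j (φ : (D.obj j).unop ⟶ twoPoints Q),
      colimit.desc F (ev x) (colimit.ι F j φ.op) =
        ULift.up (φ.functor.toFun (x.val (op j))).2 := fun x j φ =>
    ConcreteCategory.congr_hom (colimit.ι_desc (ev x) j) φ.op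
  refine small_of_injective (β := Q × (colimit F → ULift.{u} Prop))
    (f := fun x => (x.type, fun s => colimit.desc F (ev x) s)) fun x y h => ?_
  obtain ⟨h1, h2⟩ := Prod.ext_iff.1 h
  refine TypedSection.ext h1 (funext fun j => ?_)
  -- The characteristic map of `{y.val j}`, a morphism because its target is indiscrete; it is true
  -- at `y.val j`, hence also at `x.val j`.
  obtain ⟨φ, hφ⟩ := isHom_indiscrete (Prod.fst : Q × Prop → Q) (D.obj j.unop).unop
    (fun a => ((D.obj j.unop).unop.cat.type a, a = y.val j)) fun _ => rfl
  have h3 := congrFun h2 (colimit.ι F j.unop φ.op)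
  dsimp only at h3
  rw [hev, hev] at h3
  have h4 := congrArg ULift.down h3
  dsimp only at h4
  rw [hφ] at h4
  exact h4.mpr rfl

end Limits

variable (Q) in
theorem totallyCocomplete : TotallyCocomplete.{w', w} (QClosureSpace Q) := fun _ _ D hD =>
  have := fun q => hD (point q)
  hasColimit_of_hasColimit_points D

variable (Q) in
theorem totallyComplete : TotallyComplete.{w', w} (QClosureSpace Q) := fun _ _ D hD =>
  have := hD (op (twoPoints Q))
  have := small_typedSection_leftOp D
  have := hasLimit_of_small_typedSection D.leftOp
  hasColimit_of_hasLimit_leftOp D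

end QClosureSpace

end

theorem corollary3p3 (Q : Type u) [Quantaloid.{u} Q] :
    TotallyCocomplete.{w', w} (QClosureSpace Q) ∧
      TotallyComplete.{w', w} (QClosureSpace Q) ∧
      HasColimits (QClosureSpace Q) ∧ HasLimits (QClosureSpace Q) := by
  refine ⟨QClosureSpace.totallyCocomplete Q, QClosureSpace.totallyComplete Q,
    ⟨fun J _ => ⟨fun D => QClosureSpace.totallyCocomplete Q J D fun _ => inferInstance⟩⟩,
    ⟨fun J _ => ⟨fun D => ?_⟩⟩⟩
  -- For small diagrams the hypothesis is automatic, as sets have small colimits.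
  have : HasColimit D.op := QClosureSpace.totallyComplete Q Jᵒᵖ D.op fun _ => inferInstance
  exact hasLimit_of_hasColimit_op D
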